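/- Let $X$ be a zero-dimensional compact metric space (for example a Cantor set; isolated points are allowed) and let $S:X\to X$ be an aperiodic homeomorphism, i.e. every orbit $\{S^n x : n\in\mathbb Z\}$ is infinite. Suppose that $(X,S)$ has finite topological rank $K$: it is topologically conjugate to a Bratteli--Vershik system $(X_B,\varphi_B)$, where $B$ is an ordered Bratteli diagram with at most $K$ vertices at each level and $\varphi_B$ is a Vershik homeomorphism of its space of infinite paths, and $K$ is the least number for which such a model exists. A minimal component of $S$ is a nonempty closed set $Z\subseteq X$ with $S(Z)=Z$ in which the orbit of every point of $Z$ is dense. If for no minimal component $Z$ the restriction $S|_Z$ is topologically conjugate to an odometer, i.e. to the map $x\mapsto x+1$ on an inverse limit $\varprojlim \mathbb Z/q_n\mathbb Z$ with $q_n \mid q_{n+1}$ and $0<q_0<q_1<\cdots$, then $S$ is expansive: there is $\delta>0$ such that for all distinct $x,y\in X$ there is $m\in\mathbb Z$ with $d(S^m x,S^m y)>\delta$. -/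

import Mathlib

open Set

namespace BratteliVershik

/-! ### Topological dynamics of a homeomorphism -/

/-- The two-sided orbit of `x` under the homeomorphism `S`. -/
def orbit {X : Type*} [TopologicalSpace X] (S : X ≃ₜ X) (x : X) : Set X :=
  range fun n : ℤ => (S ^ n) x

/-- `S` is aperiodic: every orbit is infinite. -/
def Aperiodic {X : Type*} [TopologicalSpace X] (S : X ≃ₜ X) : Prop :=
  ∀ x, (orbit S x).Infinite

/-- `S` is expansive: some `δ > 0` is such that the orbits of any two distinct points are more
than `δ` apart at some time. -/
def Expansive {X : Type*} [MetricSpace X] (S : X ≃ₜ X) : Prop :=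
  ∃ δ : ℝ, 0 < δ ∧ ∀ x y, x ≠ y → ∃ m : ℤ, δ < dist ((S ^ m) x) ((S ^ m) y)

/-- Topological conjugacy of two self-maps. -/
def Conjugate {X Y : Type*} [TopologicalSpace X] [TopologicalSpace Y]
    (f : X → X) (g : Y → Y) : Prop :=
  ∃ h : X ≃ₜ Y, Function.Semiconj h f g

/-- `Z` is a minimal component of `S`: a nonempty closed invariant set in which every orbit
is dense. -/
structure IsMinimalComponent {X : Type*} [TopologicalSpace X] (S : X ≃ₜ X) (Z : Set X) :
    Prop where
  nonempty : Z.Nonempty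
  isClosed : IsClosed Z
  image_eq : S '' Z = Z
  subset_closure_orbit : ∀ z ∈ Z, Z ⊆ closure (orbit S z)

theorem IsMinimalComponent.mapsTo {X : Type*} [TopologicalSpace X] {S : X ≃ₜ X} {Z : Set X}
    (h : IsMinimalComponent S Z) : MapsTo S Z Z :=
  mapsTo_iff_image_subset.2 h.image_eq.subset

/-- The restriction of `S` to a minimal component. -/
def IsMinimalComponent.restriction {X : Type*} [TopologicalSpace X] {S : X ≃ₜ X} {Z : Set X}
    (h : IsMinimalComponent S Z) : Z → Z :=
  h.mapsTo.restrict S Z Z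

/-! ### Odometers -/

/-- The inverse limit of the cyclic groups `ZMod (q n)`, where `q n ∣ q (n + 1)`, with the
topology inherited from the product of the discrete spaces `ZMod (q n)`. -/
def OdometerSpace (q : ℕ → ℕ) (hq : ∀ n, q n ∣ q (n + 1)) : Type :=
  {x : ∀ n, ZMod (q n) // ∀ n, ZMod.castHom (hq n) (ZMod (q n)) (x (n + 1)) = x n}

instance (q : ℕ → ℕ) (hq : ∀ n, q n ∣ q (n + 1)) : TopologicalSpace (OdometerSpace q hq) :=
  TopologicalSpace.induced Subtype.val (@Pi.topologicalSpace ℕ (fun n => ZMod (q n)) fun _ => ⊥)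

/-- The odometer (adding machine) `x ↦ x + 1`. -/
def odometerMap (q : ℕ → ℕ) (hq : ∀ n, q n ∣ q (n + 1)) (x : OdometerSpace q hq) :
    OdometerSpace q hq :=
  ⟨fun n => x.1 n + 1, fun n => by rw [map_add, map_one, x.2 n]⟩

/-- `f` is conjugate to an odometer. (The periods `q n` are positive and strictly increasing, so
odometers are infinite.) -/
def IsOdometer {Y : Type*} [TopologicalSpace Y] (f : Y → Y) : Prop :=
  ∃ (q : ℕ → ℕ) (hq : ∀ n, q n ∣ q (n + 1)),
    (∀ n, 0 < q n) ∧ StrictMono q ∧ Conjugate f (odometerMap q hq)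

/-! ### Ordered Bratteli diagrams -/

/-- An ordered Bratteli diagram. `V n` is the `n`-th set of vertices, and `E n` is the set of
edges between `V n` and `V (n + 1)`. Each `E n` is partially ordered, two edges being comparable
if and only if they have the same range. -/
structure OrderedBratteliDiagram where
  V : ℕ → Type
  E : ℕ → Type
  finite_V : ∀ n, Finite (V n)
  finite_E : ∀ n, Finite (E n)
  card_V_zero : Nat.card (V 0) = 1
  /-- source map -/
  s : ∀ {n}, E n → V n
  /-- range map -/
  r : ∀ {n}, E n → V (n + 1)
  s_surjective : ∀ n, Function.Surjective (s (n := n))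
  r_surjective : ∀ n, Function.Surjective (r (n := n))
  order : ∀ n, PartialOrder (E n)
  comparable_iff : ∀ n (e f : E n), (e ≤ f ∨ f ≤ e) ↔ r e = r f

namespace OrderedBratteliDiagram

instance (B : OrderedBratteliDiagram) (n : ℕ) : PartialOrder (B.E n) := B.order n

/-- The space of infinite paths. -/
def PathSpace (B : OrderedBratteliDiagram) : Type :=
  {x : ∀ n, B.E n // ∀ n, B.r (x n) = B.s (x (n + 1))}

/-- The paths whose first `n` edges are those of `x`. Every finite path extends to an infinite
one, so these are all the cylinder sets. -/
def cylinder (B : OrderedBratteliDiagram) (x : B.PathSpace) (n : ℕ) : Set B.PathSpace :=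
  {y | ∀ i < n, y.1 i = x.1 i}

/-- The topology generated by the cylinder sets. -/
instance (B : OrderedBratteliDiagram) : TopologicalSpace B.PathSpace :=
  TopologicalSpace.generateFrom {U | ∃ x n, U = B.cylinder x n}

/-- The maximal paths. As comparable edges have the same range, `IsMax e` says that `e` is maximal
among the edges with the range of `e`. -/
def maxPaths (B : OrderedBratteliDiagram) : Set B.PathSpace :=
  {x | ∀ n, IsMax (x.1 n)}

/-- The minimal paths. -/
def minPaths (B : OrderedBratteliDiagram) : Set B.PathSpace :=
  {x | ∀ n, IsMin (x.1 n)}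

/-- `φ` is a Vershik homeomorphism: it maps the maximal paths onto the minimal paths, and if
`x k` is the first non-maximal edge of `x`, then `φ x` is obtained from `x` by replacing `x k` by
its successor (among the edges with the same range) and the edges before it by the minimal path
that ends at the source of this successor. -/
structure IsVershikMap (B : OrderedBratteliDiagram) (φ : B.PathSpace ≃ₜ B.PathSpace) : Prop where
  image_maxPaths : φ '' B.maxPaths = B.minPaths
  isMin_of_lt : ∀ x k, (∀ i < k, IsMax (x.1 i)) → ¬ IsMax (x.1 k) → ∀ i < k, IsMin ((φ x).1 i)
  covBy : ∀ x k, (∀ i < k, IsMax (x.1 i)) → ¬ IsMax (x.1 k) → x.1 k ⋖ (φ x).1 k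
  eq_of_gt : ∀ x k, (∀ i < k, IsMax (x.1 i)) → ¬ IsMax (x.1 k) → ∀ i > k, (φ x).1 i = x.1 i

end OrderedBratteliDiagram

/-- `S` has a Bratteli–Vershik model with at most `K` vertices at each level. -/
def HasModelOfWidthLE {X : Type*} [TopologicalSpace X] (S : X ≃ₜ X) (K : ℕ) : Prop :=
  ∃ (B : OrderedBratteliDiagram) (φ : B.PathSpace ≃ₜ B.PathSpace),
    B.IsVershikMap φ ∧ (∀ n, Nat.card (B.V n) ≤ K) ∧ Conjugate S φ

/-- `S` has topological rank `K`: it has a Bratteli–Vershik model with at most `K` vertices at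
each level, and `K` is the least number with this property. -/
def HasTopologicalRank {X : Type*} [TopologicalSpace X] (S : X ≃ₜ X) (K : ℕ) : Prop :=
  IsLeast {k | HasModelOfWidthLE S k} K

end BratteliVershik

/-! Cutting paths at level `n` partitions `X` into towers, one for each vertex; the floor of a path
is its rank among the finite paths to its vertex. These partitions are clopen, refine each other and
together separate points. It suffices to find one level whose itineraries already separate points.

A tower of level `p ≥ n` spells a word of floors of level `n`, so itineraries of level `n` are
parsed by the morphism `word n p`, and the question is whether parsings are unique. The least number
of letters through which one of these morphisms factors is nondecreasing in `n` and at most `K`,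
hence constant from some `N` on. Above `N`, parsings can be taken by elementary morphisms, which do
not factor through fewer letters (`exists_elementary`).

The core is the defect theorem `exists_factorization`: two right-infinite parsings of one word that
start at a cut with different letters make a letter superfluous. Its extra clause on first letters
covers a parsing that starts inside a word, and makes a pair of distinct two-sided parsings
deterministic. A deterministic two-sided sequence of finitely many states is periodic, so only
periodic words have two parsings (`periodic_of_ne`).

Hence a point that its `N`-itinerary fails to separate from another has a periodic itinerary at
level `N`, and then at all levels (`exists_level`). By aperiodicity the least periods are unbounded,
and the orbit closure is an odometer (`exists_odometer`), which is excluded. -/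

namespace BratteliVershik

/-! ### Parsing words by a morphism of free monoids -/

section Words

variable {A B D : Type*}

/-- A *position* `(a, i)` stands for the `i`-th letter of the word `σ a`. The position `t` may follow
the position `s` in a word parsed by `σ`. -/
def Step (σ : A → List B) (s t : A × ℕ) : Prop :=
  s.2 < (σ s.1).length ∧ (s.2 + 1 < (σ s.1).length → t = (s.1, s.2 + 1)) ∧
    ((σ s.1).length ≤ s.2 + 1 → t.2 = 0)

/-- The letter at a position. -/
def letter (σ : A → List B) (s : A × ℕ) : Option B := (σ s.1)[s.2]?

/-- A right-infinite sequence of consecutive positions. -/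
def IsParse (σ : A → List B) (ξ : ℕ → A × ℕ) : Prop := ∀ k, Step σ (ξ k) (ξ (k + 1))

theorem IsParse.shift {σ : A → List B} {ξ : ℕ → A × ℕ} (h : IsParse σ ξ) (m : ℕ) :
    IsParse σ fun k => ξ (k + m) := fun k => by
  have := h (k + m)
  rwa [show k + m + 1 = k + 1 + m by omega] at this

theorem IsParse.apply_of_lt {σ : A → List B} {ξ : ℕ → A × ℕ} (h : IsParse σ ξ) {k : ℕ}
    (hk : (ξ 0).2 + k < (σ (ξ 0).1).length) : ξ k = ((ξ 0).1, (ξ 0).2 + k) := by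
  induction k with
  | zero => rfl
  | succ k ih =>
    have := ih (by omega)
    have h1 := (h k).2.1
    rw [this] at h1
    exact h1 (by simpa [add_assoc] using hk)

theorem IsParse.snd_eq_zero {σ : A → List B} {ξ : ℕ → A × ℕ} (h : IsParse σ ξ) {k : ℕ}
    (hk : (ξ 0).2 + k = (σ (ξ 0).1).length) : (ξ k).2 = 0 := by
  have h0 := (h 0).1
  obtain ⟨k, rfl⟩ : ∃ m, k = m + 1 := ⟨k - 1, by omega⟩
  have h1 := h.apply_of_lt (k := k) (by omega)
  have h2 := (h k).2.2
  rw [h1] at h2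
  exact h2 (by simp only; omega)

/-- The position over `D` of the `i`-th letter of `τ l`, where `l` is a word over `D`. -/
def loc [Inhabited D] (τ : D → List B) : List D → ℕ → D × ℕ
  | [], _ => default
  | d :: l, i => if i < (τ d).length then (d, i) else loc τ l (i - (τ d).length)

theorem loc_spec [Inhabited D] (τ : D → List B) (hτ : ∀ d, τ d ≠ []) (l : List D) (i : ℕ)
    (hi : i < (l.flatMap τ).length) :
    (loc τ l i).2 < (τ (loc τ l i).1).length ∧ letter τ (loc τ l i) = (l.flatMap τ)[i]? ∧
    ((loc τ l i).2 + 1 < (τ (loc τ l i).1).length → i + 1 < (l.flatMap τ).length ∧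
      loc τ l (i + 1) = ((loc τ l i).1, (loc τ l i).2 + 1)) ∧
    ((τ (loc τ l i).1).length ≤ (loc τ l i).2 + 1 → i + 1 < (l.flatMap τ).length →
      (loc τ l (i + 1)).2 = 0) := by
  induction l generalizing i with
  | nil => simp at hi
  | cons d l ih =>
    simp only [List.flatMap_cons, List.length_append] at hi ⊢
    by_cases h : i < (τ d).length
    · have e : loc τ (d :: l) i = (d, i) := by simp [loc, h]
      rw [e]
      refine ⟨h, by simp [letter, List.getElem?_append_left h], fun h1 => ⟨by simp only at h1; omega, by
        simp only at h1; simp [loc, h1]⟩, fun h1 h2 => ?_⟩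
      simp only at h1
      have h3 : i + 1 = (τ d).length := by omega
      cases l with
      | nil => simp at h2; omega
      | cons e' l =>
        have := List.length_pos_iff.2 (hτ e')
        simp [loc, h3, this]
    · have e : loc τ (d :: l) i = loc τ l (i - (τ d).length) := by simp [loc, h]
      have e' : loc τ (d :: l) (i + 1) = loc τ l (i - (τ d).length + 1) := by
        rw [loc, if_neg (by omega)]; congr 1; omega
      rw [e, e']
      obtain ⟨h1, h2, h3, h4⟩ := ih (i - (τ d).length) (by omega)
      refine ⟨h1, by rw [h2, List.getElem?_append_right (by omega)], fun h5 => ⟨?_, (h3 h5).2⟩,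
        fun h5 h6 => h4 h5 (by omega)⟩
      have := (h3 h5).1
      omega

theorem loc_zero [Inhabited D] (τ : D → List B) (hτ : ∀ d, τ d ≠ []) {l : List D} {d : D}
    (h : l.head? = some d) : loc τ l 0 = (d, 0) := by
  cases l with
  | nil => simp at h
  | cons e l =>
    obtain rfl : e = d := by simpa using h
    simp [loc, List.length_pos_iff.2 (hτ e)]

/-- Rewriting a position through a factorization of the morphism. -/
def recode [Inhabited D] (α : A → List D) (τ : D → List B) (s : A × ℕ) : D × ℕ :=
  loc τ (α s.1) s.2

section Recode

variable [Inhabited D] {σ : A → List B} {α : A → List D} {τ : D → List B}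

/-- Blocks of `τ` subdivide those of `σ`, so cuts remain cuts. The hypothesis `ht` makes the next
word nonempty, which keeps `loc` away from its default value. -/
theorem Step.recode (hτ : ∀ d, τ d ≠ []) (hσ : ∀ a, σ a = (α a).flatMap τ) {s t : A × ℕ}
    (h : Step σ s t) (ht : t.2 < (σ t.1).length) : Step τ (recode α τ s) (recode α τ t) := by
  obtain ⟨h1, h2, h3⟩ := h
  rw [hσ] at h1 h2 h3
  obtain ⟨k1, -, k3, k4⟩ := loc_spec τ hτ _ _ h1
  refine ⟨k1, fun h => ?_, fun h => ?_⟩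
  · rw [h2 (k3 h).1]
    exact (k3 h).2
  · by_cases h' : s.2 + 1 < ((α s.1).flatMap τ).length
    · rw [h2 h']
      exact k4 h h'
    · have h5 := h3 (by omega)
      have h6 : α t.1 ≠ [] := fun h0 => by rw [hσ, h0] at ht; simp at ht
      obtain ⟨d, l, h7⟩ := List.exists_cons_of_ne_nil h6
      rw [BratteliVershik.recode, h5, loc_zero τ hτ (d := d) (by simp [h7])]

theorem letter_recode (hτ : ∀ d, τ d ≠ []) (hσ : ∀ a, σ a = (α a).flatMap τ) {s : A × ℕ}
    (h : s.2 < (σ s.1).length) : letter τ (recode α τ s) = letter σ s := by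
  rw [hσ] at h
  rw [recode, (loc_spec τ hτ _ _ h).2.1, letter, hσ]

theorem IsParse.recode (hτ : ∀ d, τ d ≠ []) (hσ : ∀ a, σ a = (α a).flatMap τ) {ξ : ℕ → A × ℕ}
    (h : IsParse σ ξ) : IsParse τ fun k => recode α τ (ξ k) :=
  fun k => (h k).recode hτ hσ (h (k + 1)).1

end Recode

/-- The part of the morphism that begins with the shorter one of two words, one of which is a
prefix of the other, can be split off. -/
theorem exists_split [DecidableEq D] {τ : D → List B} (hτ : ∀ d, τ d ≠ []) {ξ η : ℕ → D × ℕ}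
    (hξ : IsParse τ ξ) (hη : IsParse τ η) (hξ0 : (ξ 0).2 = 0) (hη0 : (η 0).2 = 0)
    (hl : ∀ k, letter τ (ξ k) = letter τ (η k)) {a b : D} (ha : (ξ 0).1 = a) (hb : (η 0).1 = b)
    (hab : a ≠ b) {u : List B} (hu : u ≠ []) (h : τ b = τ a ++ u) :
    (∀ d, Function.update τ b u d ≠ []) ∧
    (∀ d, τ d = (if d = b then [a, b] else [d]).flatMap (Function.update τ b u)) ∧
    ∃ ξ' η' : ℕ → D × ℕ, IsParse (Function.update τ b u) ξ' ∧ IsParse (Function.update τ b u) η' ∧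
      (ξ' 0).2 = 0 ∧ (η' 0).2 = 0 ∧
      (∀ k, letter (Function.update τ b u) (ξ' k) = letter (Function.update τ b u) (η' k)) ∧
      (ξ' 0).1 ≠ b ∧ (η' 0).1 = b := by
  have h1 : ∀ d, Function.update τ b u d ≠ [] := fun d => by
    by_cases hd : d = b
    · subst hd; simpa using hu
    · simpa [hd] using hτ d
  have h2 : ∀ d, τ d = (if d = b then [a, b] else [d]).flatMap (Function.update τ b u) := fun d => by
    by_cases hd : d = b
    · subst hd; simp [hab, h]
    · simp [hd]
  have : Inhabited D := ⟨a⟩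
  refine ⟨h1, h2, _, _, (hξ.shift (τ a).length).recode h1 h2, (hη.shift (τ a).length).recode h1 h2,
    ?_⟩
  have e1 : (ξ (τ a).length).2 = 0 := hξ.snd_eq_zero (by rw [hξ0, ha, zero_add])
  have e2 : η (τ a).length = (b, (τ a).length) := by
    rw [hη.apply_of_lt, hη0, hb, zero_add]
    rw [hη0, hb, h, List.length_append]
    have := List.length_pos_iff.2 hu
    omega
  -- The parsing `ξ` has a cut here. A letter `b` is now spelled `a b`, so the recoded `ξ` cannot
  -- start with `b`, whereas the recoded `η` starts with the `b` that stands for `u`.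
  have e3 : recode (fun d => if d = b then [a, b] else [d]) (Function.update τ b u)
      (ξ (0 + (τ a).length)) = (if (ξ (τ a).length).1 = b then a else (ξ (τ a).length).1, 0) := by
    rw [zero_add, recode, e1]
    apply loc_zero _ h1
    split_ifs <;> simp
  have e4 : recode (fun d => if d = b then [a, b] else [d]) (Function.update τ b u)
      (η (0 + (τ a).length)) = (b, 0) := by
    rw [zero_add, e2, recode]
    simp [loc, hab, List.length_pos_iff.2 hu]
  refine ⟨by rw [e3], by rw [e4], fun k => ?_, ?_, by rw [e4]⟩
  · rw [letter_recode h1 h2 (hξ _).1, letter_recode h1 h2 (hη _).1, hl]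
  · rw [e3]
    simp only
    split_ifs with h5
    · exact hab
    · exact h5

/-- Both first words are prefixes of the same infinite word. -/
theorem eq_append_of_letter_eq {τ : D → List B} {ξ η : ℕ → D × ℕ} (hξ : IsParse τ ξ)
    (hη : IsParse τ η) (hξ0 : (ξ 0).2 = 0) (hη0 : (η 0).2 = 0)
    (hl : ∀ k, letter τ (ξ k) = letter τ (η k)) (h : (τ (ξ 0).1).length ≤ (τ (η 0).1).length) :
    ∃ u, τ (η 0).1 = τ (ξ 0).1 ++ u := by
  refine ⟨(τ (η 0).1).drop (τ (ξ 0).1).length, ?_⟩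
  refine List.ext_getElem? fun i => ?_
  by_cases hi : i < (τ (ξ 0).1).length
  · rw [List.getElem?_append_left hi]
    have := hl i
    rw [hξ.apply_of_lt (by omega), hη.apply_of_lt (by omega)] at this
    simpa [letter, hξ0, hη0] using this.symm
  · rw [List.getElem?_append_right (by omega), List.getElem?_drop]
    congr 1
    omega

/-- Two different parsings of the same right-infinite word allow to factor the morphism through a
smaller alphabet, each letter of which is the first letter of the image of some letter. -/
theorem exists_factorization [Fintype D] (n : ℕ) : ∀ (τ : D → List B), (∀ d, τ d ≠ []) →
    ∑ d, (τ d).length ≤ n → ∀ ξ η : ℕ → D × ℕ, IsParse τ ξ → IsParse τ η → (ξ 0).2 = 0 →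
    (η 0).2 = 0 → (∀ k, letter τ (ξ k) = letter τ (η k)) → (ξ 0).1 ≠ (η 0).1 →
    ∃ k < Fintype.card D, ∃ (β : D → List (Fin k)) (τ' : Fin k → List B), (∀ c, τ' c ≠ []) ∧
      (∀ d, τ d = (β d).flatMap τ') ∧ ∀ c, ∃ d, d ≠ (η 0).1 ∧ (β d).head? = some c := by
  classical
  induction n with
  | zero =>
    intro τ hτ hn ξ
    have h1 : (τ (ξ 0).1).length ≤ ∑ d, (τ d).length :=
      Finset.single_le_sum (f := fun d => (τ d).length) (fun _ _ => Nat.zero_le _)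
        (Finset.mem_univ (ξ 0).1)
    have := List.length_pos_iff.2 (hτ (ξ 0).1)
    omega
  | succ n ih =>
    intro τ hτ hn ξ η hξ hη hξ0 hη0 hl hne
    -- Induction on the total length: splitting off `τ a` removes at least one letter.
    have hsum : ∀ a b : D, ∀ u, τ b = τ a ++ u → ∑ d, (Function.update τ b u d).length ≤ n := by
      intro a b u h
      have : ∑ d, (Function.update τ b u d).length < ∑ d, (τ d).length := by
        have := List.length_pos_iff.2 (hτ a)
        refine Finset.sum_lt_sum (fun d _ => ?_) ⟨b, Finset.mem_univ _, ?_⟩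
        · by_cases hd : d = b
          · subst hd; simp [h]
          · simp [hd]
        · simp [h]; omega
      omega
    by_cases heq : τ (ξ 0).1 = τ (η 0).1
    -- Two letters with the same word: `(η 0).1` is replaced by `(ξ 0).1`.
    · let e := Fintype.equivFin {d // d ≠ (η 0).1}
      refine ⟨Fintype.card {d // d ≠ (η 0).1}, Fintype.card_subtype_lt (x := (η 0).1) (by simp),
        fun d => if h : d = (η 0).1 then [e ⟨(ξ 0).1, hne⟩] else [e ⟨d, h⟩],
        fun c => τ (e.symm c), fun c => hτ _, fun d => ?_,
        fun c => ⟨(e.symm c).1, (e.symm c).2, ?_⟩⟩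
      · by_cases h : d = (η 0).1
        · simp [h, heq]
        · simp [h]
      · simp [(e.symm c).2]
    rcases le_total (τ (ξ 0).1).length (τ (η 0).1).length with hle | hle
    · obtain ⟨u, hu⟩ := eq_append_of_letter_eq hξ hη hξ0 hη0 hl hle
      have hu0 : u ≠ [] := by rintro rfl; simp [hu] at heq
      obtain ⟨h1, h2, ξ', η', h3, h4, h5, h6, h7, h8, h9⟩ :=
        exists_split hτ hξ hη hξ0 hη0 hl rfl rfl hne hu0 hu
      obtain ⟨k, hk, β, τ', k1, k2, k3⟩ := ih _ h1 (hsum _ _ u hu) ξ' η' h3 h4 h5 h6 h7 (h9 ▸ h8)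
      refine ⟨k, hk, fun d => (if d = (η 0).1 then [(ξ 0).1, (η 0).1] else [d]).flatMap β, τ', k1,
        fun d => ?_, fun c => ?_⟩
      · rw [List.flatMap_assoc, h2 d]
        congr 1
        exact funext k2
      · obtain ⟨d, hd, hc⟩ := k3 c
        rw [h9] at hd
        exact ⟨d, hd, by simp [hd, hc]⟩
    · obtain ⟨u, hu⟩ := eq_append_of_letter_eq hη hξ hη0 hξ0 (fun k => (hl k).symm) hle
      have hu0 : u ≠ [] := by rintro rfl; simp [hu] at heq
      obtain ⟨h1, h2, η', ξ', h3, h4, h5, h6, h7, h8, h9⟩ :=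
        exists_split hτ hη hξ hη0 hξ0 (fun k => (hl k).symm) rfl rfl hne.symm hu0 hu
      obtain ⟨k, hk, β, τ', k1, k2, k3⟩ := ih _ h1 (hsum _ _ u hu) η' ξ' h3 h4 h5 h6 h7 (h9 ▸ h8)
      refine ⟨k, hk, fun d => (if d = (ξ 0).1 then [(η 0).1, (ξ 0).1] else [d]).flatMap β, τ', k1,
        fun d => ?_, fun c => ?_⟩
      · rw [List.flatMap_assoc, h2 d]
        congr 1
        exact funext k2
      · obtain ⟨d, hd, hc⟩ := k3 c
        rw [h9] at hd
        -- With the roles exchanged, the induction excludes `(ξ 0).1` instead. That letter is now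
        -- spelled with `(η 0).1` in front, so it can stand in for `(η 0).1`.
        by_cases hd' : d = (η 0).1
        · refine ⟨(ξ 0).1, hne, ?_⟩
          subst hd'
          simp [hc]
        · exact ⟨d, hd', by simp [hd, hc]⟩

/-- The morphism `σ` factors through the free monoid on `k` letters. -/
def Factors (σ : A → List B) (k : ℕ) : Prop :=
  ∃ (α : A → List (Fin k)) (τ : Fin k → List B), (∀ c, τ c ≠ []) ∧ ∀ a, σ a = (α a).flatMap τ

/-- An elementary morphism: a non-erasing one that does not factor through a smaller alphabet. -/
structure Elementary [Fintype A] (σ : A → List B) : Prop where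
  ne_nil : ∀ a, σ a ≠ []
  card_le : ∀ k, Factors σ k → Fintype.card A ≤ k

theorem Elementary.of_comp [Fintype A] {σ : A → List B} (hσ : Elementary σ) {k : ℕ}
    (hk : k ≤ Fintype.card A) {α : A → List (Fin k)} {τ : Fin k → List B} (hτ : ∀ c, τ c ≠ [])
    (h : ∀ a, σ a = (α a).flatMap τ) : Elementary τ where
  ne_nil := hτ
  card_le := by
    rintro m ⟨β, τ', h1, h2⟩
    rw [Fintype.card_fin]
    refine hk.trans (hσ.card_le m ⟨fun a => (α a).flatMap β, τ', h1, fun a => ?_⟩)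
    rw [List.flatMap_assoc, h a]
    congr 1
    exact funext h2

/-- Elementary morphisms are injective on right-infinite words. -/
theorem Elementary.parse_unique [Fintype A] {σ : A → List B} (hσ : Elementary σ) {ξ η : ℕ → A × ℕ}
    (hξ : IsParse σ ξ) (hη : IsParse σ η) (hξ0 : (ξ 0).2 = 0) (hη0 : (η 0).2 = 0)
    (hl : ∀ k, letter σ (ξ k) = letter σ (η k)) (k : ℕ) : ξ k = η k := by
  -- The defect theorem gives agreement at common cuts; equal positions then stay equal up to the
  -- next cut, which is again common.
  have key : ∀ m, (ξ m).2 = 0 → (η m).2 = 0 → ξ m = η m := by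
    intro m h1 h2
    by_contra hne
    obtain ⟨k, hk, β, τ', k1, k2, -⟩ := exists_factorization _ σ hσ.ne_nil le_rfl _ _ (hξ.shift m)
      (hη.shift m) (by simpa using h1) (by simpa using h2) (fun k => hl _) (fun h => hne (by
        rw [zero_add] at h
        exact Prod.ext h (h1.trans h2.symm)))
    exact absurd (hσ.card_le k ⟨β, τ', k1, k2⟩) (by omega)
  induction k with
  | zero => exact key 0 hξ0 hη0
  | succ k ih =>
    have h1 := hξ k
    have h2 := hη k
    rw [← ih] at h2
    by_cases h : (ξ k).2 + 1 < (σ (ξ k).1).length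
    · rw [h1.2.1 h, h2.2.1 h]
    · exact key _ (h1.2.2 (by omega)) (h2.2.2 (by omega))

end Words
-- Recognizability of two-sided words
section TwoSided

variable {A B : Type*}

theorem isParse_some {σ : A → List B} {ξ : ℕ → A × ℕ} (h : IsParse σ ξ) (u : List B) :
    IsParse (fun o : Option A => o.elim u σ) fun k => (some (ξ k).1, (ξ k).2) := fun k =>
  ⟨(h k).1, fun h1 => by
    have := (h k).2.1 h1
    simp [this], fun h1 => (h k).2.2 h1⟩

/-- A new letter, spelled by the rest of the word in which `η` starts, turns the start of `η` into a
cut. -/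
theorem isParse_none {σ : A → List B} {η : ℕ → A × ℕ} (h : IsParse σ η) :
    IsParse (fun o : Option A => o.elim ((σ (η 0).1).drop (η 0).2) σ) (fun k =>
      if (η 0).2 + k < (σ (η 0).1).length then (none, k) else (some (η k).1, (η k).2)) ∧
    ∀ k, letter (fun o : Option A => o.elim ((σ (η 0).1).drop (η 0).2) σ)
      (if (η 0).2 + k < (σ (η 0).1).length then (none, k) else (some (η k).1, (η k).2)) =
      letter σ (η k) := by
  have h0 := (h 0).1
  refine ⟨fun k => ?_, fun k => ?_⟩
  · beta_reduce
    by_cases h1 : (η 0).2 + k < (σ (η 0).1).length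
    · rw [if_pos h1]
      refine ⟨by simp; omega, fun h2 => ?_, fun h2 => ?_⟩
      · simp only [Option.elim_none, List.length_drop] at h2
        rw [if_pos (by omega)]
      · simp only [Option.elim_none, List.length_drop] at h2
        rw [if_neg (by omega)]
        exact h.snd_eq_zero (by omega)
    · rw [if_neg h1, if_neg (by omega)]
      exact isParse_some h _ k
  · by_cases h1 : (η 0).2 + k < (σ (η 0).1).length
    · rw [if_pos h1, h.apply_of_lt h1]
      simp [letter]
    · rw [if_neg h1]
      rfl

/-- If an elementary morphism parses the same right-infinite word in two ways, and only the second
parsing starts possibly inside the image of a letter, then its first position determines the first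
letter of the first parsing. -/
theorem Elementary.apply_zero_eq [Fintype A] {σ : A → List B} (hσ : Elementary σ)
    {ξ η ξ' η' : ℕ → A × ℕ} (hξ : IsParse σ ξ) (hη : IsParse σ η) (hξ' : IsParse σ ξ')
    (hη' : IsParse σ η') (h0 : (ξ 0).2 = 0) (h0' : (ξ' 0).2 = 0) (hη0 : η 0 = η' 0)
    (hl : ∀ k, letter σ (ξ k) = letter σ (η k)) (hl' : ∀ k, letter σ (ξ' k) = letter σ (η' k)) :
    ξ 0 = ξ' 0 := by
  have hb := (hη 0).1
  obtain ⟨p1, l1⟩ := isParse_none hη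
  obtain ⟨p2, l2⟩ := isParse_none hη'
  rw [← hη0] at p2 l2
  set u := (σ (η 0).1).drop (η 0).2 with hu
  set σ' : Option A → List B := fun o => o.elim u σ with hσ'
  have hne : ∀ o, σ' o ≠ [] := by
    rintro (_ | a)
    · intro h
      have : u.length = 0 := by rw [show u = [] from h]; rfl
      rw [hu, List.length_drop] at this
      omega
    · exact hσ.ne_nil a
  obtain ⟨k, hk, β, τ, k1, k2, k3⟩ := exists_factorization _ σ' hne le_rfl _ _
    (isParse_some hξ u) p1 (by simpa using h0) (by simp [hb])
    (fun k => by rw [l1 k, ← hl k]; rfl) (by simp [hb])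
  -- `Option A` has just one letter more than `A`, so elementarity of `σ` leaves exactly
  -- `Fintype.card A` letters, and `τ` is elementary too.
  have hk1 : Fintype.card A ≤ k := hσ.card_le k ⟨fun a => β (some a), τ, k1, fun a => k2 (some a)⟩
  have hk2 : k = Fintype.card A := by rw [Fintype.card_option] at hk; omega
  have hτ : Elementary τ := hσ.of_comp hk2.le k1 fun a => k2 (some a)
  have hhead : ∀ o, ∃ c, (β o).head? = some c := fun o => by
    have : β o ≠ [] := fun h => hne o (by rw [k2 o, h]; rfl)
    obtain ⟨c, l, h⟩ := List.exists_cons_of_ne_nil this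
    exact ⟨c, by simp [h]⟩
  choose f hf using hhead
  -- Every new letter begins the spelling of some letter other than `none`; equal cardinalities turn
  -- this surjection into an injection.
  have hinj : Function.Injective fun a => f (some a) := by
    refine ((Fintype.bijective_iff_surjective_and_card _).2 ⟨fun c => ?_, by simp [hk2]⟩).1
    obtain ⟨d, hd, hc⟩ := k3 c
    rcases d with _ | a
    · simp [hb] at hd
    · exact ⟨a, by simpa [hf] using hc⟩
  have : Inhabited (Fin k) := ⟨f none⟩
  have hz : ∀ o, recode β τ (o, 0) = (f o, 0) := fun o => loc_zero τ k1 (hf o)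
  -- Recoded by the elementary `τ`, both parsings start at a cut and so agree. Since `β` and `τ`
  -- depend only on the common first position, `f none` is the same for both pairs.
  have key : ∀ ξ η : ℕ → A × ℕ, IsParse σ ξ → (ξ 0).2 = 0 →
      IsParse σ' (fun k => if (η 0).2 + k < (σ (η 0).1).length then (none, k)
        else (some (η k).1, (η k).2)) → (η 0).2 < (σ (η 0).1).length →
      (∀ k, letter σ' (if (η 0).2 + k < (σ (η 0).1).length then (none, k)
        else (some (η k).1, (η k).2)) = letter σ (η k)) →
      (∀ k, letter σ (ξ k) = letter σ (η k)) → f (some (ξ 0).1) = f none := by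
    intro ξ η hξ hξ0 hη hη0 hl1 hl2
    have hs := isParse_some hξ u
    have := hτ.parse_unique (hs.recode k1 k2) (hη.recode k1 k2) ?_ ?_ ?_ 0
    · simpa [hξ0, hη0, hz] using this
    · simp [hξ0, hz]
    · simp [hη0, hz]
    · intro k
      rw [letter_recode k1 k2 (hs k).1, letter_recode k1 k2 (hη k).1, hl1, ← hl2]
      rfl
  have e1 := key ξ η hξ h0 p1 hb l1 hl
  rw [hη0] at p2 l2
  have e2 := key ξ' η' hξ' h0' p2 (hη0 ▸ hb) l2 hl'
  exact Prod.ext (hinj (e1.trans e2.symm)) (h0.trans h0'.symm)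

theorem exists_lt_eq_of_finite_range {Q : Type*} {s : ℤ → Q} (hs : (range s).Finite) (p : ℤ) :
    ∃ i j, p - (range s).ncard ≤ i ∧ i < j ∧ j ≤ p ∧ s i = s j := by
  classical
  obtain ⟨i, hi, j, hj, hij, h⟩ := Finset.exists_ne_map_eq_of_card_lt_of_maps_to
    (s := Finset.Icc (p - (range s).ncard) p) (t := hs.toFinset) (f := s)
    (by rw [← ncard_eq_toFinset_card _ hs, Int.card_Icc]; omega) (fun i _ => by simp)
  rw [Finset.mem_Icc] at hi hj
  rcases lt_or_gt_of_ne hij with h1 | h1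
  · exact ⟨i, j, hi.1, h1, hj.2, h⟩
  · exact ⟨j, i, hj.1, h1, hi.2, h.symm⟩

/-- A two-sided sequence of finitely many states, each determined by the preceding one, is
periodic. -/
theorem exists_periodic_of_deterministic {Q : Type*} {s : ℤ → Q} (hs : (range s).Finite)
    (h : ∀ i j, s i = s j → s (i + 1) = s (j + 1)) : ∃ P : ℕ, 0 < P ∧ Function.Periodic s (P : ℤ) := by
  -- Each `p` ends a window with a repetition at distance at most `(range s).ncard`; the factorial
  -- is a multiple of all these distances.
  refine ⟨(range s).ncard.factorial, Nat.factorial_pos _, fun p => ?_⟩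
  obtain ⟨i, j, h1, h2, h3, h4⟩ := exists_lt_eq_of_finite_range hs p
  have h5 : ∀ t : ℕ, s (i + t) = s (j + t) := fun t => by
    induction t with
    | zero => simpa using h4
    | succ t ih => simpa [add_assoc] using h _ _ ih
  obtain ⟨d, hd⟩ : ∃ d : ℕ, j = i + d := ⟨(j - i).toNat, by omega⟩
  have h6 : ∀ m : ℕ, s (p + m * d) = s p := fun m => by
    induction m with
    | zero => simp
    | succ m ih =>
      rw [← ih]
      have := h5 (p + m * d - i).toNat
      have h7 : 0 ≤ (m : ℤ) * d := by positivity
      rw [Int.toNat_of_nonneg (by omega)] at this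
      rw [show i + (p + m * d - i) = p + m * d by ring] at this
      rw [this, hd]
      congr 1
      push_cast
      ring
  obtain ⟨m, hm⟩ : d ∣ (range s).ncard.factorial := Nat.dvd_factorial (by omega) (by omega)
  rw [hm, mul_comm]
  exact_mod_cast h6 m

/-- A two-sided sequence of consecutive positions. -/
def IsBiparse (σ : A → List B) (ξ : ℤ → A × ℕ) : Prop := ∀ k, Step σ (ξ k) (ξ (k + 1))

theorem IsBiparse.isParse {σ : A → List B} {ξ : ℤ → A × ℕ} (h : IsBiparse σ ξ) (p : ℤ) :
    IsParse σ fun k : ℕ => ξ (p + k) := fun k => by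
  have := h (p + k)
  rwa [show p + (k : ℤ) + 1 = p + ((k + 1 : ℕ) : ℤ) by push_cast; ring] at this

theorem IsBiparse.finite_range [Finite A] {σ : A → List B} {ξ : ℤ → A × ℕ} (h : IsBiparse σ ξ) :
    (range ξ).Finite := by
  have := Fintype.ofFinite A
  refine (finite_univ.prod (finite_Iio (∑ a, (σ a).length))).subset ?_
  rintro _ ⟨k, rfl⟩
  exact ⟨mem_univ _, (h k).1.trans_le
    (Finset.single_le_sum (f := fun a => (σ a).length) (fun _ _ => Nat.zero_le _)
      (Finset.mem_univ (ξ k).1))⟩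

theorem Step.snd_eq_zero_iff {σ : A → List B} {s t : A × ℕ} (h : Step σ s t) :
    t.2 = 0 ↔ (σ s.1).length ≤ s.2 + 1 := by
  refine ⟨fun h1 => ?_, h.2.2⟩
  by_contra h2
  rw [h.2.1 (by omega)] at h1
  simp at h1

variable [Fintype A] {σ : A → List B} {ξ η : ℤ → A × ℕ}

theorem Elementary.biparse_eq_of_le (hσ : Elementary σ) (hξ : IsBiparse σ ξ) (hη : IsBiparse σ η)
    {i j : ℤ} (hl : ∀ k : ℕ, letter σ (ξ (i + k)) = letter σ (η (j + k))) (h1 : (ξ i).2 = 0)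
    (h2 : (η j).2 = 0) (k : ℕ) : ξ (i + k) = η (j + k) :=
  hσ.parse_unique (hξ.isParse i) (hη.isParse j) (by simpa using h1) (by simpa using h2) hl k

/-- Inside a word the next position is forced. Where only one parsing has a cut, the position of the
other one forces its next letter, by `Elementary.apply_zero_eq`. -/
theorem Elementary.biparse_succ_eq (hσ : Elementary σ) (hξ : IsBiparse σ ξ) (hη : IsBiparse σ η)
    (hl : ∀ k, letter σ (ξ k) = letter σ (η k)) {i j : ℤ}
    (hcut : ¬ ((ξ (i + 1)).2 = 0 ∧ (η (i + 1)).2 = 0)) (h1 : ξ i = ξ j) (h2 : η i = η j) :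
    ξ (i + 1) = ξ (j + 1) ∧ η (i + 1) = η (j + 1) := by
  have key : ∀ ξ η : ℤ → A × ℕ, IsBiparse σ ξ → IsBiparse σ η →
      (∀ k, letter σ (ξ k) = letter σ (η k)) → ξ i = ξ j → η i = η j →
      (ξ (i + 1)).2 = 0 → (η (i + 1)).2 ≠ 0 → ξ (i + 1) = ξ (j + 1) ∧ η (i + 1) = η (j + 1) := by
    intro ξ η hξ hη hl h1 h2 h3 h4
    have h5 : η (i + 1) = η (j + 1) := by
      rw [Ne, (hη i).snd_eq_zero_iff, not_le] at h4
      rw [(hη i).2.1 h4, (hη j).2.1 (h2 ▸ h4), h2]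
    have h6 : (ξ (j + 1)).2 = 0 := by rwa [(hξ j).snd_eq_zero_iff, ← h1, ← (hξ i).snd_eq_zero_iff]
    refine ⟨?_, h5⟩
    simpa using hσ.apply_zero_eq (hξ.isParse (i + 1)) (hη.isParse (i + 1)) (hξ.isParse (j + 1))
      (hη.isParse (j + 1)) (by simpa using h3) (by simpa using h6) (by simpa using h5)
      (fun k => hl _) (fun k => hl _)
  by_cases h3 : (ξ (i + 1)).2 = 0
  · exact key ξ η hξ hη hl h1 h2 h3 fun h => hcut ⟨h3, h⟩
  · by_cases h4 : (η (i + 1)).2 = 0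
    · exact (key η ξ hη hξ (fun k => (hl k).symm) h2 h1 h4 h3).symm
    · have e : ∀ ξ : ℤ → A × ℕ, IsBiparse σ ξ → ξ i = ξ j → (ξ (i + 1)).2 ≠ 0 →
          ξ (i + 1) = ξ (j + 1) := by
        intro η hη h2 h4
        rw [Ne, (hη i).snd_eq_zero_iff, not_le] at h4
        rw [(hη i).2.1 h4, (hη j).2.1 (h2 ▸ h4), h2]
      exact ⟨e ξ hξ h1 h3, e η hη h2 h4⟩

/-- Two different parsings of a two-sided word by an elementary morphism have no common cut. -/
theorem Elementary.no_common_cut (hσ : Elementary σ) (hξ : IsBiparse σ ξ) (hη : IsBiparse σ η)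
    (hl : ∀ k, letter σ (ξ k) = letter σ (η k)) (hne : ξ ≠ η) (p : ℤ) :
    ¬ ((ξ p).2 = 0 ∧ (η p).2 = 0) := by
  intro hp
  obtain ⟨q, hq⟩ := Function.ne_iff.1 hne
  -- The parsings agree to the right of a common cut, so none lies to the left of `q`, and there is
  -- a leftmost one.
  obtain ⟨c, ⟨hc1, hc2⟩, hmin⟩ := Int.exists_least_of_bdd
    (P := fun p => (ξ p).2 = 0 ∧ (η p).2 = 0) ⟨q, fun z hz => by
      by_contra h
      apply hq
      have := hσ.biparse_eq_of_le hξ hη (fun k => hl _) hz.1 hz.2 (q - z).toNat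
      rwa [show z + ((q - z).toNat : ℤ) = q by omega] at this⟩ ⟨p, hp⟩
  -- Before `c` the pair is deterministic, so a repeated state propagates to `c - 1` and yields a
  -- common cut to the left of `c`.
  obtain ⟨i, j, -, hij, hjc, h⟩ := exists_lt_eq_of_finite_range
    (s := fun k => (ξ k, η k)) ((hξ.finite_range.prod hη.finite_range).subset
      (by rintro _ ⟨k, rfl⟩; exact ⟨⟨k, rfl⟩, ⟨k, rfl⟩⟩)) (c - 1)
  have h1 : ∀ t : ℕ, j + t ≤ c - 1 → ξ (i + t) = ξ (j + t) ∧ η (i + t) = η (j + t) := by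
    intro t
    induction t with
    | zero => simpa using fun _ => h
    | succ t ih =>
      intro ht
      push_cast at ht ⊢
      obtain ⟨h2, h3⟩ := ih (by omega)
      rw [← add_assoc, ← add_assoc]
      refine hσ.biparse_succ_eq hξ hη hl (fun h4 => ?_) h2 h3
      have := hmin _ h4
      omega
  obtain ⟨h2, h3⟩ := h1 (c - 1 - j).toNat (by omega)
  rw [show j + ((c - 1 - j).toNat : ℤ) = c - 1 by omega] at h2 h3
  set m := i + ((c - 1 - j).toNat : ℤ) with hm
  have h4 := hmin (m + 1) ⟨?_, ?_⟩
  · omega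
  · rw [(hξ m).snd_eq_zero_iff, h2, ← (hξ (c - 1)).snd_eq_zero_iff, sub_add_cancel, hc1]
  · rw [(hη m).snd_eq_zero_iff, h3, ← (hη (c - 1)).snd_eq_zero_iff, sub_add_cancel, hc2]

/-- Recognizability: a two-sided word with two parsings by an elementary morphism is periodic. -/
theorem Elementary.periodic_of_ne (hσ : Elementary σ) (hξ : IsBiparse σ ξ) (hη : IsBiparse σ η)
    (hl : ∀ k, letter σ (ξ k) = letter σ (η k)) (hne : ξ ≠ η) :
    ∃ P : ℕ, 0 < P ∧ Function.Periodic (fun k => letter σ (ξ k)) (P : ℤ) := by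
  obtain ⟨P, hP, h⟩ := exists_periodic_of_deterministic
    (s := fun k => (ξ k, η k)) ((hξ.finite_range.prod hη.finite_range).subset
      (by rintro _ ⟨k, rfl⟩; exact ⟨⟨k, rfl⟩, ⟨k, rfl⟩⟩)) (fun i j h => by
      rw [Prod.mk.injEq] at h ⊢
      exact hσ.biparse_succ_eq hξ hη hl (hσ.no_common_cut hξ hη hl hne _) h.1 h.2)
  exact ⟨P, hP, fun k => by
    have := (Prod.mk.injEq .. ▸ h k : _ ∧ _).1
    simp only [this]⟩

/-- A parsing of a periodic two-sided word by an elementary morphism is periodic. -/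
theorem Elementary.periodic_biparse (hσ : Elementary σ) (hξ : IsBiparse σ ξ) {P : ℕ} (hP : 0 < P)
    (h : Function.Periodic (fun k => letter σ (ξ k)) (P : ℤ)) :
    ∃ Q : ℕ, 0 < Q ∧ Function.Periodic ξ (Q : ℤ) := by
  have h1 : ∀ i j : ℤ, i % P = j % P → ∀ k : ℕ, letter σ (ξ (i + k)) = letter σ (ξ (j + k)) := by
    intro i j hij k
    obtain ⟨m, hm⟩ := Int.ModEq.dvd hij
    have := (h.int_mul m) (i + k)
    simp only [Int.cast_id] at this
    rw [← this]
    congr 2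
    linarith
  -- At a cut the residue modulo `P` determines the word to the right, hence the next position;
  -- elsewhere the current position does.
  obtain ⟨Q, hQ, h2⟩ := exists_periodic_of_deterministic
    (s := fun k => (ξ k, k % (P : ℤ))) ((hξ.finite_range.prod (finite_Ico 0 (P : ℤ))).subset (by
      rintro _ ⟨k, rfl⟩
      exact ⟨⟨k, rfl⟩, Int.emod_nonneg _ (by omega), Int.emod_lt_of_pos _ (by omega)⟩))
      (fun i j h => by
        rw [Prod.mk.injEq] at h ⊢
        have h4 : (i + 1) % (P : ℤ) = (j + 1) % P := Int.ModEq.add_right 1 h.2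
        refine ⟨?_, h4⟩
        by_cases h3 : (ξ (i + 1)).2 = 0
        · have h5 : (ξ (j + 1)).2 = 0 := by
            rwa [(hξ j).snd_eq_zero_iff, ← h.1, ← (hξ i).snd_eq_zero_iff]
          simpa using hσ.biparse_eq_of_le hξ hξ (h1 _ _ h4) h3 h5 0
        · rw [(hξ i).snd_eq_zero_iff, not_le] at h3
          rw [(hξ i).2.1 h3, (hξ j).2.1 (h.1 ▸ h3), h.1])
  exact ⟨Q, hQ, fun k => (Prod.mk.injEq .. ▸ h2 k : _ ∧ _).1⟩

end TwoSided
/-! ### Refining sequences of tower partitions -/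

section Towers

variable {X : Type*} [TopologicalSpace X]

theorem zpow_add_one_apply (S : X ≃ₜ X) (k : ℤ) (x : X) : (S ^ (k + 1)) x = S ((S ^ k) x) := by
  rw [add_comm, zpow_one_add]
  rfl

theorem zpow_add_apply (S : X ≃ₜ X) (i j : ℤ) (x : X) : (S ^ (i + j)) x = (S ^ i) ((S ^ j) x) := by
  rw [zpow_add]
  rfl

/-- The floor `t` of a tower may be visited right after the floor `s`, where `(v, i)` is the `i`-th
floor of the tower `v` of height `H v`: it is the next one of the same tower, or a ground floor. -/
def TowerStep {V : Type*} (H : V → ℕ) (s t : V × ℕ) : Prop :=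
  s.2 < H s.1 ∧ (s.2 + 1 < H s.1 → t = (s.1, s.2 + 1)) ∧ (H s.1 ≤ s.2 + 1 → t.2 = 0)

/-- A refining sequence of partitions of `X` into towers: `κ n x = (v, i)` says that `x` is on the
`i`-th floor of the tower `v` of the `n`-th partition. -/
structure TowerSystem (S : X ≃ₜ X) where
  V : ℕ → Type
  finite_V : ∀ n, Finite (V n)
  height : ∀ n, V n → ℕ
  κ : ∀ n, X → V n × ℕ
  step : ∀ n x, TowerStep (height n) (κ n x) (κ n (S x))
  refines : ∀ n x y, κ (n + 1) x = κ (n + 1) y → κ n x = κ n y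
  surj : ∀ n v, ∃ x, (κ n x).1 = v

namespace TowerSystem

variable {S : X ≃ₜ X} (T : TowerSystem S)

instance (n : ℕ) : Finite (T.V n) := T.finite_V n

theorem refines_of_le {n p : ℕ} (h : n ≤ p) {x y : X} (hxy : T.κ p x = T.κ p y) :
    T.κ n x = T.κ n y := by
  induction p, h using Nat.le_induction with
  | base => exact hxy
  | succ p _ ih => exact ih (T.refines p x y hxy)

theorem exists_base (n : ℕ) (v : T.V n) : ∃ x, T.κ n x = (v, 0) := by
  have key : ∀ (h : ℕ) (x : X), T.κ n x = (v, h) → ∃ y, T.κ n y = (v, 0) := by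
    intro h
    induction h with
    | zero => exact fun x hx => ⟨x, hx⟩
    | succ h ih =>
      intro x hx
      have h1 := T.step n (S.symm x)
      rw [S.apply_symm_apply, hx] at h1
      obtain ⟨-, h2, h3⟩ := h1
      by_cases h4 : (T.κ n (S.symm x)).2 + 1 < T.height n (T.κ n (S.symm x)).1
      · have h5 := h2 h4
        simp only [Prod.mk.injEq, add_left_inj] at h5
        exact ih _ (Prod.ext h5.1.symm h5.2.symm)
      · exact absurd (h3 (by omega)) (by simp)
  obtain ⟨x, hx⟩ := T.surj n v
  exact key (T.κ n x).2 x (Prod.ext hx rfl)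

/-- A point on the ground floor of a tower. -/
noncomputable def base (n : ℕ) (v : T.V n) : X := (T.exists_base n v).choose

theorem κ_base (n : ℕ) (v : T.V n) : T.κ n (T.base n v) = (v, 0) := (T.exists_base n v).choose_spec

theorem height_pos (n : ℕ) (v : T.V n) : 0 < T.height n v := by
  have := (T.step n (T.base n v)).1
  rwa [T.κ_base] at this

theorem κ_zpow_base {n : ℕ} {v : T.V n} {i : ℕ} (hi : i < T.height n v) :
    T.κ n ((S ^ (i : ℤ)) (T.base n v)) = (v, i) := by
  induction i with
  | zero => exact T.κ_base n v
  | succ i ih =>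
    have h := (T.step n ((S ^ (i : ℤ)) (T.base n v))).2.1
    rw [ih (by omega)] at h
    push_cast
    rw [zpow_add_one_apply]
    exact h hi

/-- The word of floors of the `n`-th partition that are met along a tower of the `p`-th one. -/
noncomputable def word (n p : ℕ) (v : T.V p) : List (T.V n × ℕ) :=
  (List.range (T.height p v)).map fun i : ℕ => T.κ n ((S ^ (i : ℤ)) (T.base p v))

theorem length_word (n p : ℕ) (v : T.V p) : (T.word n p v).length = T.height p v := by
  simp [word]

/-- The choice of base point is immaterial: a floor of level `p` lies in a single floor of level
`n`. -/
theorem letter_word {n p : ℕ} (h : n ≤ p) (x : X) :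
    letter (T.word n p) (T.κ p x) = some (T.κ n x) := by
  have h1 := (T.step p x).1
  rw [letter, word, List.getElem?_map, List.getElem?_range h1, Option.map_some,
    T.refines_of_le h (T.κ_zpow_base h1)]

theorem step_word (n p : ℕ) (x : X) : Step (T.word n p) (T.κ p x) (T.κ p (S x)) := by
  simpa only [Step, TowerStep, length_word] using T.step p x

/-- The number of letters of the smallest alphabet through which one of the words of floors of the
`n`-th partition factors. -/
noncomputable def rank (n : ℕ) : ℕ := sInf {k | ∃ p ≥ n, Factors (T.word n p) k}

theorem card_mem (n : ℕ) : Nat.card (T.V n) ∈ {k | ∃ p ≥ n, Factors (T.word n p) k} := by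
  let e := Finite.equivFin (T.V n)
  refine ⟨n, le_rfl, fun v => [e v], fun c => T.word n n (e.symm c), fun c => ?_, fun v => by simp⟩
  rw [← List.length_pos_iff, length_word]
  exact T.height_pos n _

theorem rank_le_card (n : ℕ) : T.rank n ≤ Nat.card (T.V n) := Nat.sInf_le (T.card_mem n)

theorem rank_spec (n : ℕ) : ∃ p ≥ n, Factors (T.word n p) (T.rank n) := Nat.sInf_mem ⟨_, T.card_mem n⟩

theorem exists_truncation [Nonempty X] {n q : ℕ} (h : n ≤ q) :
    ∃ t : T.V q × ℕ → T.V n × ℕ, ∀ x, t (T.κ q x) = T.κ n x :=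
  ⟨Function.extend (T.κ q) (T.κ n) fun _ => T.κ n (Classical.arbitrary X),
    Function.FactorsThrough.extend_apply (fun _ _ => T.refines_of_le h) _⟩

/-- Truncating letters to level `n` carries a factorization at level `n + 1` over to level `n`, with
the same alphabet. -/
theorem rank_mono [Nonempty X] : Monotone T.rank := by
  refine monotone_nat_of_le_succ fun n => Nat.sInf_le ?_
  obtain ⟨p, hp, α, τ, h1, h2⟩ := T.rank_spec (n + 1)
  obtain ⟨t, ht⟩ := T.exists_truncation (Nat.le_succ n)
  refine ⟨p, by omega, α, fun c => (τ c).map t, fun c => by simpa using h1 c, fun v => ?_⟩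
  rw [← List.map_flatMap, ← h2 v, word, word, List.map_map]
  exact congrArg (fun f => List.map f _) (funext fun i => (ht _).symm)

/-- Above a level where the rank has stabilized, every partition is determined by positions in words
given by an elementary morphism. -/
theorem exists_elementary [Nonempty X] {N q : ℕ} (h : N ≤ q) (hr : T.rank q = T.rank N) :
    ∃ ε : Fin (T.rank N) → List (T.V N × ℕ), Elementary ε ∧ ∃ ζ : X → Fin (T.rank N) × ℕ,
      (∀ x, IsBiparse ε fun k => ζ ((S ^ k) x)) ∧ (∀ x, letter ε (ζ x) = some (T.κ N x)) ∧
      ∀ x y, ζ x = ζ y → T.κ q x = T.κ q y := by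
  obtain ⟨p, hp, hf⟩ := T.rank_spec q
  rw [hr] at hf
  obtain ⟨α, τ, h1, h2⟩ := hf
  obtain ⟨t, ht⟩ := T.exists_truncation h
  have : Inhabited (Fin (T.rank N)) := by
    let x := Classical.arbitrary X
    have h3 := (T.step_word q p x).1
    rw [h2] at h3
    exact ⟨(α (T.κ p x).1).head fun h => by simp [h] at h3⟩
  have hl : ∀ x, letter τ (recode α τ (T.κ p x)) = some (T.κ q x) := fun x => by
    rw [letter_recode h1 h2 (T.step_word q p x).1, T.letter_word hp]
  -- The second factor is read at level `N`. A smaller alphabet for it would factor `word N p`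
  -- through fewer than `rank N` letters; before truncation, its letters still show the floor of
  -- level `q`.
  refine ⟨fun c => (τ c).map t, ⟨fun c => by simpa using h1 c, ?_⟩,
    fun x => recode α τ (T.κ p x), fun x k => ?_, fun x => ?_, fun x y hxy => ?_⟩
  · rintro m ⟨β, τ', k1, k2⟩
    rw [Fintype.card_fin]
    refine Nat.sInf_le ⟨p, by omega, fun v => (α v).flatMap β, τ', k1, fun v => ?_⟩
    rw [List.flatMap_assoc, ← funext k2, ← List.map_flatMap, ← h2, word, word, List.map_map]
    exact congrArg (fun f => List.map f _) (funext fun i => (ht _).symm)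
  · have := (T.step_word q p ((S ^ k) x)).recode h1 h2 (T.step_word q p _).1
    simpa only [Step, List.length_map, zpow_add_one_apply] using this
  · have := hl x
    rw [letter] at this
    rw [letter, List.getElem?_map, this, Option.map_some, ht]
  · have := hl x
    beta_reduce at hxy
    rw [hxy, hl y] at this
    exact (Option.some_injective _ this).symm

/-- In a sequence of partitions with boundedly many towers, some level is such that the itinerary of
`x` in this level determines all positions of `x`, except possibly if the itineraries of `x` in all
levels are periodic. -/
theorem exists_level [Nonempty X] {K : ℕ} (hK : ∀ n, Nat.card (T.V n) ≤ K) :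
    ∃ N, ∀ x y, (∀ k : ℤ, T.κ N ((S ^ k) x) = T.κ N ((S ^ k) y)) → (∀ q, T.κ q x = T.κ q y) ∨
      ∀ q, ∃ P : ℕ, 0 < P ∧ Function.Periodic (fun k : ℤ => T.κ q ((S ^ k) x)) (P : ℤ) := by
  have hbdd : BddAbove (range T.rank) :=
    ⟨K, by rintro _ ⟨n, rfl⟩; exact (T.rank_le_card n).trans (hK n)⟩
  obtain ⟨N, hN⟩ := Nat.sSup_mem (range_nonempty T.rank) hbdd
  have hr : ∀ q, N ≤ q → T.rank q = T.rank N := fun q hq =>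
    le_antisymm (hN ▸ le_csSup hbdd ⟨q, rfl⟩) (T.rank_mono hq)
  refine ⟨N, fun x y hxy => ?_⟩
  by_cases hc : ∃ P : ℕ, 0 < P ∧ Function.Periodic (fun k : ℤ => T.κ N ((S ^ k) x)) (P : ℤ)
  · right
    intro q
    obtain ⟨P, hP, hper⟩ := hc
    obtain ⟨ε, hε, ζ, h1, h2, h3⟩ := T.exists_elementary (le_max_left N q) (hr _ (le_max_left N q))
    obtain ⟨Q, hQ, h4⟩ := hε.periodic_biparse (h1 x) hP fun k => by
      simp only [h2, Option.some.injEq]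
      exact hper k
    exact ⟨Q, hQ, fun k => T.refines_of_le (le_max_right N q) (h3 _ _ (h4 k))⟩
  · left
    intro q
    obtain ⟨ε, hε, ζ, h1, h2, h3⟩ := T.exists_elementary (le_max_left N q) (hr _ (le_max_left N q))
    refine T.refines_of_le (le_max_right N q) (h3 x y ?_)
    by_contra hne
    obtain ⟨P, hP, hper⟩ := hε.periodic_of_ne (h1 x) (h1 y) (fun k => by rw [h2, h2, hxy])
      fun h => hne (congrFun h 0)
    refine hc ⟨P, hP, fun k => ?_⟩
    have := hper k
    simpa only [h2, Option.some.injEq] using this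

end TowerSystem
end Towers
/-! ### The towers of a Bratteli–Vershik system -/

namespace OrderedBratteliDiagram

variable (B : OrderedBratteliDiagram)

instance (n : ℕ) : Finite (B.V n) := B.finite_V n

noncomputable instance (n : ℕ) : Fintype (B.E n) := @Fintype.ofFinite _ (B.finite_E n)

open Classical in
/-- The number of finite paths that end at a vertex. -/
noncomputable def height : ∀ n, B.V n → ℕ
  | 0, _ => 1
  | n + 1, v => ∑ e : B.E n with B.r e = v, height n (B.s e)

open Classical in
/-- The number of finite paths whose last edge is less than `e`. -/
noncomputable def below {n : ℕ} (e : B.E n) : ℕ := ∑ f : B.E n with f < e, B.height n (B.s f)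

variable {B}

theorem r_eq_of_le {n : ℕ} {e f : B.E n} (h : e ≤ f) : B.r e = B.r f :=
  (B.comparable_iff n e f).1 (Or.inl h)

theorem le_or_le_of_r_eq {n : ℕ} {e f : B.E n} (h : B.r e = B.r f) : e ≤ f ∨ f ≤ e :=
  (B.comparable_iff n e f).2 h

open Classical in
theorem below_add_height {n : ℕ} (e : B.E n) :
    B.below e + B.height n (B.s e) = ∑ f : B.E n with f ≤ e, B.height n (B.s f) := by
  have : Finset.univ.filter (fun f : B.E n => f ≤ e) =
      insert e (Finset.univ.filter fun f => f < e) := by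
    ext f
    simp [le_iff_lt_or_eq, or_comm]
  rw [this, Finset.sum_insert (by simp), add_comm, below]

theorem below_add_height_le {n : ℕ} (e : B.E n) :
    B.below e + B.height n (B.s e) ≤ B.height (n + 1) (B.r e) := by
  classical
  rw [below_add_height, height]
  refine Finset.sum_le_sum_of_subset fun f hf => ?_
  simp only [Finset.mem_filter, Finset.mem_univ, true_and] at hf ⊢
  exact r_eq_of_le hf

theorem below_add_height_of_isMax {n : ℕ} {e : B.E n} (h : IsMax e) :
    B.below e + B.height n (B.s e) = B.height (n + 1) (B.r e) := by
  classical
  rw [below_add_height, height]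
  congr 1
  ext f
  simp only [Finset.mem_filter, Finset.mem_univ, true_and]
  exact ⟨r_eq_of_le, fun hf => (le_or_le_of_r_eq hf).elim id fun h' => h h'⟩

theorem below_add_height_le_below {n : ℕ} {e f : B.E n} (h : e < f) :
    B.below e + B.height n (B.s e) ≤ B.below f := by
  classical
  rw [below_add_height, below]
  refine Finset.sum_le_sum_of_subset fun g hg => ?_
  simp only [Finset.mem_filter, Finset.mem_univ, true_and] at hg ⊢
  exact hg.trans_lt h

theorem below_of_covBy {n : ℕ} {e f : B.E n} (h : e ⋖ f) :
    B.below f = B.below e + B.height n (B.s e) := by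
  classical
  rw [below_add_height, below]
  congr 1
  ext g
  simp only [Finset.mem_filter, Finset.mem_univ, true_and]
  refine ⟨fun hg => ?_, fun hg => hg.trans_lt h.1⟩
  rcases le_or_le_of_r_eq ((r_eq_of_le hg.le).trans (r_eq_of_le h.1.le).symm) with h1 | h1
  · exact h1
  · rcases h1.lt_or_eq with h2 | h2
    · exact absurd hg (h.2 h2)
    · exact h2.symm.le

theorem below_of_isMin {n : ℕ} {e : B.E n} (h : IsMin e) : B.below e = 0 := by
  classical
  rw [below]
  refine Finset.sum_eq_zero fun f hf => ?_
  simp only [Finset.mem_filter, Finset.mem_univ, true_and] at hf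
  exact absurd hf h.not_lt

/-- The vertex of a path at a level. -/
def vertex (n : ℕ) (x : B.PathSpace) : B.V n := B.s (x.1 n)

theorem vertex_succ (n : ℕ) (x : B.PathSpace) : vertex (n + 1) x = B.r (x.1 n) := (x.2 n).symm

/-- The number of finite paths that precede the first `n` edges of `x`. -/
noncomputable def offset : ℕ → B.PathSpace → ℕ
  | 0, _ => 0
  | n + 1, x => B.below (x.1 n) + offset n x

theorem offset_lt (n : ℕ) (x : B.PathSpace) : offset n x < B.height n (vertex n x) := by
  induction n with
  | zero => simp [offset, height]
  | succ n ih =>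
    rw [vertex_succ, offset]
    have := below_add_height_le (x.1 n)
    rw [vertex] at ih
    omega

theorem offset_of_isMin {n : ℕ} {x : B.PathSpace} (h : ∀ i < n, IsMin (x.1 i)) :
    offset n x = 0 := by
  induction n with
  | zero => rfl
  | succ n ih => rw [offset, ih fun i hi => h i (by omega), below_of_isMin (h n (by omega))]

theorem offset_of_isMax {n : ℕ} {x : B.PathSpace} (h : ∀ i < n, IsMax (x.1 i)) :
    offset n x + 1 = B.height n (vertex n x) := by
  induction n with
  | zero => rfl
  | succ n ih =>
    rw [vertex_succ, offset, ← below_add_height_of_isMax (h n (by omega)), add_assoc,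
      ih fun i hi => h i (by omega), vertex]

section Vershik

variable {φ : B.PathSpace ≃ₜ B.PathSpace} (hφ : B.IsVershikMap φ)
include hφ

theorem IsVershikMap.vertex_apply {n k : ℕ} (hk : k < n) {x : B.PathSpace}
    (h1 : ∀ i < k, IsMax (x.1 i)) (h2 : ¬ IsMax (x.1 k)) : vertex n (φ x) = vertex n x := by
  obtain ⟨n, rfl⟩ : ∃ m, n = m + 1 := ⟨n - 1, by omega⟩
  rw [vertex_succ, vertex_succ]
  rcases (Nat.lt_succ_iff.1 hk).lt_or_eq with h | rfl
  · rw [hφ.eq_of_gt x k h1 h2 n h]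
  · exact (r_eq_of_le (hφ.covBy x k h1 h2).1.le).symm

theorem IsVershikMap.offset_apply {n k : ℕ} (hk : k < n) {x : B.PathSpace}
    (h1 : ∀ i < k, IsMax (x.1 i)) (h2 : ¬ IsMax (x.1 k)) :
    offset n (φ x) = offset n x + 1 := by
  induction n, hk using Nat.le_induction with
  | base =>
    have h3 := offset_of_isMax h1
    rw [vertex] at h3
    rw [offset, offset, below_of_covBy (hφ.covBy x k h1 h2),
      offset_of_isMin (hφ.isMin_of_lt x k h1 h2)]
    omega
  | succ n hn ih => rw [offset, offset, ih, hφ.eq_of_gt x k h1 h2 n hn, add_assoc]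

theorem IsVershikMap.offset_apply_eq_zero {n : ℕ} {x : B.PathSpace}
    (h : ∀ i < n, IsMax (x.1 i)) : offset n (φ x) = 0 := by
  classical
  refine offset_of_isMin fun i hi => ?_
  by_cases hx : x ∈ B.maxPaths
  · have : φ x ∈ B.minPaths := hφ.image_maxPaths ▸ mem_image_of_mem φ hx
    exact this i
  · have hx' : ∃ k, ¬ IsMax (x.1 k) := by simpa [maxPaths] using hx
    have h1 : n ≤ Nat.find hx' := by
      by_contra h1
      exact Nat.find_spec hx' (h _ (by omega))
    exact hφ.isMin_of_lt x _ (fun j hj => not_not.1 (Nat.find_min hx' hj)) (Nat.find_spec hx') i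
      (by omega)

/-- If the first `n` edges are all maximal, the path is on a top floor and its image starts with `n`
minimal edges. Otherwise the Vershik map moves to the next finite path with the same end. -/
theorem IsVershikMap.towerStep (n : ℕ) (x : B.PathSpace) :
    TowerStep (B.height n) (vertex n x, offset n x) (vertex n (φ x), offset n (φ x)) := by
  classical
  by_cases h : ∀ i < n, IsMax (x.1 i)
  · have := offset_of_isMax h
    exact ⟨offset_lt n x, fun h' => by simp only at h'; omega, fun _ => hφ.offset_apply_eq_zero h⟩
  · have hx : ∃ k, k < n ∧ ¬ IsMax (x.1 k) := by simpa using h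
    obtain ⟨h1, h2⟩ := Nat.find_spec hx
    have h3 : ∀ i < Nat.find hx, IsMax (x.1 i) := fun i hi => by
      have := Nat.find_min hx hi
      simp only [not_and, not_not] at this
      exact this (by omega)
    have h4 := hφ.vertex_apply h1 h3 h2
    have h5 := hφ.offset_apply h1 h3 h2
    have h6 := offset_lt n (φ x)
    rw [h4, h5] at h6
    exact ⟨offset_lt n x, fun _ => by rw [h4, h5], fun h' => by simp only at h'; omega⟩

end Vershik

/-- Offsets of finite paths through different edges to one vertex fill disjoint intervals. -/
theorem edge_eq {n : ℕ} {x y : B.PathSpace} (hv : vertex (n + 1) x = vertex (n + 1) y)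
    (ho : offset (n + 1) x = offset (n + 1) y) : x.1 n = y.1 n := by
  have key : ∀ x y : B.PathSpace, offset (n + 1) x = offset (n + 1) y → ¬ x.1 n < y.1 n := by
    intro x y h hlt
    have h1 := below_add_height_le_below hlt
    have h2 := offset_lt n x
    rw [offset, offset] at h
    rw [vertex] at h2
    omega
  rw [vertex_succ, vertex_succ] at hv
  rcases le_or_le_of_r_eq hv with h | h
  · exact h.eq_of_not_lt (key x y ho)
  · exact (h.eq_of_not_lt (key y x ho.symm)).symm

theorem vertex_eq_and_offset_eq {n : ℕ} {x y : B.PathSpace}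
    (hv : vertex (n + 1) x = vertex (n + 1) y) (ho : offset (n + 1) x = offset (n + 1) y) :
    vertex n x = vertex n y ∧ offset n x = offset n y := by
  have h := edge_eq hv ho
  refine ⟨by rw [vertex, vertex, h], ?_⟩
  rw [offset, offset, h] at ho
  omega

theorem offset_congr {n : ℕ} {x y : B.PathSpace} (h : ∀ i < n, x.1 i = y.1 i) :
    offset n x = offset n y := by
  induction n with
  | zero => rfl
  | succ n ih => rw [offset, offset, h n (by omega), ih fun i hi => h i (by omega)]

theorem isOpen_cylinder (x : B.PathSpace) (n : ℕ) : IsOpen (B.cylinder x n) :=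
  TopologicalSpace.isOpen_generateFrom_of_mem ⟨x, n, rfl⟩

variable {X : Type*} [TopologicalSpace X] {S : X ≃ₜ X} {φ : B.PathSpace ≃ₜ B.PathSpace}

/-- The towers of a system with a Bratteli–Vershik model. -/
noncomputable def IsVershikMap.towers (hφ : B.IsVershikMap φ) (h : X ≃ₜ B.PathSpace)
    (hS : Function.Semiconj h S φ) : TowerSystem S where
  -- Restricting to vertices met by infinite paths makes `surj` immediate.
  V n := range (vertex (B := B) n)
  finite_V _ := inferInstance
  height n v := B.height n v.1
  κ n x := (⟨vertex n (h x), h x, rfl⟩, offset n (h x))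
  step n x := by
    obtain ⟨h1, h2, h3⟩ := hφ.towerStep n (h x)
    rw [← hS.eq x] at h2 h3
    refine ⟨h1, fun h4 => ?_, h3⟩
    have h5 := h2 h4
    rw [Prod.mk.injEq] at h5 ⊢
    exact ⟨Subtype.ext h5.1, h5.2⟩
  refines n x y hxy := by
    rw [Prod.mk.injEq] at hxy ⊢
    have := vertex_eq_and_offset_eq (congrArg Subtype.val hxy.1) hxy.2
    exact ⟨Subtype.ext this.1, this.2⟩
  surj n := by
    rintro ⟨v, x, rfl⟩
    exact ⟨h.symm x, by simp⟩

section

variable (hφ : B.IsVershikMap φ) (h : X ≃ₜ B.PathSpace) (hS : Function.Semiconj h S φ)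

theorem IsVershikMap.card_towers_le (n : ℕ) :
    Nat.card ((hφ.towers h hS).V n) ≤ Nat.card (B.V n) :=
  Nat.card_le_card_of_injective Subtype.val Subtype.val_injective

theorem IsVershikMap.eq_of_κ_eq {x y : X}
    (hxy : ∀ n, (hφ.towers h hS).κ n x = (hφ.towers h hS).κ n y) : x = y := by
  refine h.injective (Subtype.ext (funext fun n => ?_))
  have := hxy (n + 1)
  simp only [towers, Prod.mk.injEq] at this
  exact edge_eq (congrArg Subtype.val this.1) this.2

theorem IsVershikMap.isLocallyConstant_κ (n : ℕ) :
    IsLocallyConstant ((hφ.towers h hS).κ n) := by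
  refine (IsLocallyConstant.iff_exists_open _).2 fun x =>
    ⟨h ⁻¹' B.cylinder (h x) (n + 1), (isOpen_cylinder _ _).preimage h.continuous,
      fun _ _ => rfl, fun y hy => ?_⟩
  have hy' : ∀ i < n + 1, (h y).1 i = (h x).1 i := hy
  simp only [towers, Prod.mk.injEq]
  exact ⟨Subtype.ext (congrArg B.s (hy' n (by omega))), offset_congr fun i hi => hy' i (by omega)⟩

end

end OrderedBratteliDiagram
/-! ### Orbit closures that are odometers -/

section Orbits

variable {X : Type*} [TopologicalSpace X] {S : X ≃ₜ X}

theorem self_mem_orbit (S : X ≃ₜ X) (x : X) : x ∈ orbit S x := ⟨0, by simp⟩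

theorem zpow_mem_closure_orbit {x y : X} (hy : y ∈ closure (orbit S x)) (k : ℤ) :
    (S ^ k) y ∈ closure (orbit S x) := by
  refine map_mem_closure (S ^ k).continuous hy ?_
  rintro _ ⟨i, rfl⟩
  exact ⟨k + i, zpow_add_apply S k i x⟩

theorem closure_orbit_subset {x y : X} (hy : y ∈ closure (orbit S x)) :
    closure (orbit S y) ⊆ closure (orbit S x) := by
  refine closure_minimal ?_ isClosed_closure
  rintro _ ⟨k, rfl⟩
  exact zpow_mem_closure_orbit hy k

theorem image_closure_orbit (x : X) : S '' closure (orbit S x) = closure (orbit S x) := by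
  rw [S.image_closure]
  congr 1
  ext y
  constructor
  · rintro ⟨_, ⟨k, rfl⟩, rfl⟩
    exact ⟨k + 1, zpow_add_one_apply S k x⟩
  · rintro ⟨k, rfl⟩
    exact ⟨(S ^ (k - 1)) x, ⟨k - 1, rfl⟩, by rw [← zpow_add_one_apply, sub_add_cancel]⟩

theorem Aperiodic.not_periodic (hS : Aperiodic S) (x : X) {P : ℕ} (hP : 0 < P) :
    ¬ Function.Periodic (fun k : ℤ => (S ^ k) x) (P : ℤ) := fun h => by
  refine hS x ?_
  rw [orbit, ← Function.Periodic.image_Ioc h (by exact_mod_cast hP) 0]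
  exact (finite_Ioc _ _).image _

end Orbits

/-- The periods form a subgroup of `ℤ`, which is cyclic, and nonzero because of `P`. -/
theorem exists_period {D : Type*} {f : ℤ → D} {P : ℕ} (hP : 0 < P)
    (h : Function.Periodic f (P : ℤ)) :
    ∃ q : ℕ, 0 < q ∧ ∀ d : ℤ, Function.Periodic f d ↔ (q : ℤ) ∣ d := by
  let H : AddSubgroup ℤ :=
    { carrier := {d | Function.Periodic f d}
      zero_mem' := fun k => by simp
      add_mem' := fun ha hb => ha.add_period hb
      neg_mem' := fun ha => ha.neg }
  obtain ⟨a, ha⟩ := Int.subgroup_cyclic H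
  have h1 : ∀ d : ℤ, Function.Periodic f d ↔ (a.natAbs : ℤ) ∣ d := fun d => by
    rw [Int.natAbs_dvd, ← Int.mem_zmultiples_iff, AddSubgroup.zmultiples_eq_closure, ← ha]
    rfl
  refine ⟨a.natAbs, Nat.pos_of_ne_zero fun h0 => ?_, h1⟩
  have := (h1 P).1 h
  rw [h0] at this
  simp at this
  omega

instance (q : ℕ → ℕ) (hq : ∀ n, q n ∣ q (n + 1)) : T2Space (OdometerSpace q hq) := by
  let _ : ∀ n, TopologicalSpace (ZMod (q n)) := fun _ => ⊥
  have : ∀ n, DiscreteTopology (ZMod (q n)) := fun _ => ⟨rfl⟩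
  exact T2Space.of_injective_continuous (f := fun x : OdometerSpace q hq => x.1)
    Subtype.val_injective continuous_induced_dom

/-! ### Odometers from periodic itineraries -/

section Odometer

variable {X : Type*} [TopologicalSpace X] {S : X ≃ₜ X} {D : ℕ → Type*}
  {c : ∀ n, X → D n} {x₀ : X} {q : ℕ → ℕ}

/-- The points with the same itinerary as `S ^ a` of a base point. -/
def sameItinerary (S : X ≃ₜ X) (c : ∀ n, X → D n) (x₀ : X) (n : ℕ) (a : ℤ) : Set X :=
  {z | ∀ i : ℤ, c n ((S ^ i) z) = c n ((S ^ (i + a)) x₀)}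

theorem isClosed_sameItinerary (hc : ∀ n, IsLocallyConstant (c n)) (n : ℕ) (a : ℤ) :
    IsClosed (sameItinerary S c x₀ n a) := by
  rw [sameItinerary, ofPred_forall]
  exact isClosed_iInter fun i => ((hc n).comp_continuous (S ^ i).continuous).isClosed_fiber _

theorem zpow_mem_sameItinerary {n : ℕ} {a : ℤ} {z : X} (hz : z ∈ sameItinerary S c x₀ n a)
    (k : ℤ) : (S ^ k) z ∈ sameItinerary S c x₀ n (a + k) := fun i => by
  rw [← zpow_add_apply, hz (i + k), add_assoc, add_comm k]

theorem orbit_mem_sameItinerary (n : ℕ) (k : ℤ) : (S ^ k) x₀ ∈ sameItinerary S c x₀ n k :=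
  fun i => by rw [← zpow_add_apply]

theorem sameItinerary_succ_subset (hr : ∀ n x y, c (n + 1) x = c (n + 1) y → c n x = c n y)
    (n : ℕ) (a : ℤ) : sameItinerary S c x₀ (n + 1) a ⊆ sameItinerary S c x₀ n a :=
  fun _ hz i => hr n _ _ (hz i)

theorem mem_sameItinerary_iff
    (hq : ∀ n (d : ℤ), Function.Periodic (fun k : ℤ => c n ((S ^ k) x₀)) d ↔ (q n : ℤ) ∣ d)
    {n : ℕ} {a : ℤ} {z : X} (hz : z ∈ sameItinerary S c x₀ n a) (b : ℤ) :
    z ∈ sameItinerary S c x₀ n b ↔ (a : ZMod (q n)) = b := by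
  rw [ZMod.intCast_eq_intCast_iff_dvd_sub, ← hq]
  constructor
  · intro h i
    have h1 := hz (i - a)
    rw [h (i - a), sub_add_cancel] at h1
    rw [show i + (b - a) = i - a + b by ring]
    exact h1
  · intro h i
    rw [hz i, show i + b = i + a + (b - a) by ring]
    exact (h (i + a)).symm

/-- If all itineraries of `x₀` are periodic, with unbounded periods, then the closure of its orbit
is a minimal component that is conjugate to an odometer. -/
theorem exists_odometer_of_periods [CompactSpace X] [T2Space X]
    (hc : ∀ n, IsLocallyConstant (c n))
    (hr : ∀ n x y, c (n + 1) x = c (n + 1) y → c n x = c n y)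
    (hsep : ∀ x y, (∀ n, c n x = c n y) → x = y)
    (hq : ∀ n (d : ℤ), Function.Periodic (fun k : ℤ => c n ((S ^ k) x₀)) d ↔ (q n : ℤ) ∣ d)
    (hpos : ∀ n, 0 < q n) (hdvd : ∀ n, q n ∣ q (n + 1)) (hmono : StrictMono q) :
    ∃ (Z : Set X) (hZ : IsMinimalComponent S Z), IsOdometer hZ.restriction := by
  have hne : ∀ n, NeZero (q n) := fun n => ⟨(hpos n).ne'⟩
  set Z := closure (orbit S x₀) with hZdef
  set F := sameItinerary S c x₀ with hF
  have hx₀ : x₀ ∈ Z := subset_closure (self_mem_orbit S x₀)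
  -- One closed set for each residue modulo `q n` covers the orbit; a finite union is closed, so it
  -- covers the closure.
  have hcover : ∀ z ∈ Z, ∀ n, ∃ a : ℤ, z ∈ F n a := by
    intro z hz n
    have h1 : IsClosed (⋃ a ∈ Ico (0 : ℤ) (q n), F n a) :=
      (finite_Ico _ _).isClosed_biUnion fun a _ => isClosed_sameItinerary hc n a
    have h2 : orbit S x₀ ⊆ ⋃ a ∈ Ico (0 : ℤ) (q n), F n a := by
      rintro _ ⟨k, rfl⟩
      have h3 : (0 : ℤ) < q n := by exact_mod_cast hpos n
      refine mem_biUnion (x := k % (q n : ℤ))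
        ⟨Int.emod_nonneg _ h3.ne', Int.emod_lt_of_pos _ h3⟩ ?_
      rw [hF, mem_sameItinerary_iff hq (orbit_mem_sameItinerary n k)]
      simp
    obtain ⟨a, -, h3⟩ := mem_iUnion₂.1 (closure_minimal h2 h1 hz)
    exact ⟨a, h3⟩
  have haddr : ∀ (z : Z) (n : ℕ), ∃ u : ZMod (q n), ∀ a : ℤ, z.1 ∈ F n a ↔ u = a := fun z n => by
    obtain ⟨a, ha⟩ := hcover z z.2 n
    exact ⟨a, mem_sameItinerary_iff hq ha⟩
  choose addr haddr using haddr
  have hinj : ∀ x y : X, (∀ n, ∃ a, x ∈ F n a ∧ y ∈ F n a) → x = y := fun x y h =>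
    hsep x y fun n => by
      obtain ⟨a, h1, h2⟩ := h n
      simpa using (h1 0).trans (h2 0).symm
  -- Shifts move a point of `W` into any prescribed class of level `n`, and compactness handles all
  -- levels at once. For `W` an orbit closure this gives minimality, for `W = Z` surjectivity of the
  -- address map.
  have hexists : ∀ W ⊆ Z, W.Nonempty → IsClosed W → (∀ w ∈ W, ∀ k : ℤ, (S ^ k) w ∈ W) →
      ∀ u : OdometerSpace q hdvd, ∃ w ∈ W, ∀ n, ∃ a : ℤ, u.1 n = a ∧ w ∈ F n a := by
    intro W hWZ hWne hWc hWS u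
    choose a ha using fun n => ZMod.intCast_surjective (u.1 n)
    have hclosed : ∀ n, IsClosed (W ∩ F n (a n)) := fun n =>
      hWc.inter (isClosed_sameItinerary hc _ _)
    have hanti : ∀ n, W ∩ F (n + 1) (a (n + 1)) ⊆ W ∩ F n (a n) := fun n w hw => by
      refine ⟨hw.1, ?_⟩
      rw [hF, mem_sameItinerary_iff hq (sameItinerary_succ_subset hr n _ hw.2), ha n, ← u.2 n,
        ← ha (n + 1), map_intCast]
    have hnonempty : ∀ n, (W ∩ F n (a n)).Nonempty := fun n => by
      obtain ⟨w, hw⟩ := hWne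
      obtain ⟨b, hb⟩ := hcover w (hWZ hw) n
      refine ⟨(S ^ (a n - b)) w, hWS w hw _, ?_⟩
      have := zpow_mem_sameItinerary hb (a n - b)
      rwa [add_sub_cancel] at this
    obtain ⟨w, hw⟩ := IsCompact.nonempty_iInter_of_sequence_nonempty_isCompact_isClosed _ hanti
      hnonempty (hclosed 0).isCompact hclosed
    rw [mem_iInter] at hw
    exact ⟨w, (hw 0).1, fun n => ⟨a n, (ha n).symm, (hw n).2⟩⟩
  have hZ : IsMinimalComponent S Z := by
    refine ⟨⟨x₀, hx₀⟩, isClosed_closure, image_closure_orbit x₀, fun z hz => ?_⟩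
    obtain ⟨w, hw, h⟩ := hexists (closure (orbit S z)) (closure_orbit_subset hz)
      ⟨z, subset_closure (self_mem_orbit S z)⟩ isClosed_closure
      (fun w hw k => zpow_mem_closure_orbit hw k) ⟨fun _ => 0, fun n => map_zero _⟩
    have : w = x₀ := hinj _ _ fun n => by
      obtain ⟨a, h1, h2⟩ := h n
      refine ⟨a, h2, ?_⟩
      have := orbit_mem_sameItinerary (S := S) (c := c) (x₀ := x₀) n 0
      rw [zpow_zero] at this
      exact (mem_sameItinerary_iff hq this a).2 (by simpa using h1)
    exact closure_orbit_subset (this ▸ hw)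
  refine ⟨Z, hZ, q, hdvd, hpos, hmono, ?_⟩
  have hcompat : ∀ (z : Z) n, ZMod.castHom (hdvd n) (ZMod (q n)) (addr z (n + 1)) = addr z n := by
    intro z n
    obtain ⟨a, ha⟩ := hcover z z.2 (n + 1)
    rw [(haddr z (n + 1) a).1 ha, (haddr z n a).1 (sameItinerary_succ_subset hr n _ ha),
      map_intCast]
  let Θ : Z → OdometerSpace q hdvd := fun z => ⟨addr z, hcompat z⟩
  have hΘ : Function.Bijective Θ := by
    refine ⟨fun z z' h => Subtype.ext (hinj _ _ fun n => ?_), fun u => ?_⟩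
    · obtain ⟨a, ha⟩ := hcover z z.2 n
      refine ⟨a, ha, (haddr z' n a).2 ?_⟩
      rw [← (haddr z n a).1 ha]
      exact (congrFun (congrArg Subtype.val h) n).symm
    · obtain ⟨w, hw, h⟩ := hexists Z subset_rfl ⟨x₀, hx₀⟩ isClosed_closure
        (fun w hw k => zpow_mem_closure_orbit hw k) u
      refine ⟨⟨w, hw⟩, Subtype.ext (funext fun n => ?_)⟩
      obtain ⟨a, h1, h2⟩ := h n
      exact ((haddr ⟨w, hw⟩ n a).1 h2).trans h1.symm
  have hcont : Continuous Θ := by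
    refine continuous_induced_rng.2 ?_
    let _ : ∀ n, TopologicalSpace (ZMod (q n)) := fun _ => ⊥
    refine continuous_pi fun n => ?_
    have hclosed : ∀ t : Set (ZMod (q n)), IsClosed ((fun z => addr z n) ⁻¹' t) := by
      intro t
      rw [← biUnion_preimage_singleton]
      refine t.toFinite.isClosed_biUnion fun u _ => ?_
      obtain ⟨a, rfl⟩ := ZMod.intCast_surjective u
      convert (isClosed_sameItinerary hc n a).preimage (continuous_subtype_val (p := (· ∈ Z)))
      ext z
      exact (haddr z n a).symm
    have : IsLocallyConstant fun z => addr z n := fun s => by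
      rw [← isClosed_compl_iff, ← preimage_compl]
      exact hclosed _
    exact this.continuous
  have : CompactSpace Z := isCompact_iff_compactSpace.1 isClosed_closure.isCompact
  refine ⟨Continuous.homeoOfEquivCompactToT2 (f := Equiv.ofBijective Θ hΘ) hcont, fun z => ?_⟩
  refine Subtype.ext (funext fun n => ?_)
  obtain ⟨a, ha⟩ := hcover z z.2 n
  have h1 : S z.1 ∈ F n (a + 1) := by
    have := zpow_mem_sameItinerary ha 1
    rwa [zpow_one] at this
  change addr (hZ.restriction z) n = addr z n + 1
  rw [(haddr z n a).1 ha, (haddr (hZ.restriction z) n (a + 1)).1 h1]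
  push_cast
  rfl

/-- In an aperiodic system, a point all of whose itineraries are periodic gives rise to a minimal
component that is conjugate to an odometer. -/
theorem exists_odometer [CompactSpace X] [T2Space X] (hS : Aperiodic S)
    (hc : ∀ n, IsLocallyConstant (c n))
    (hr : ∀ n x y, c (n + 1) x = c (n + 1) y → c n x = c n y)
    (hsep : ∀ x y, (∀ n, c n x = c n y) → x = y)
    (hper : ∀ n, ∃ P : ℕ, 0 < P ∧ Function.Periodic (fun k : ℤ => c n ((S ^ k) x₀)) (P : ℤ)) :
    ∃ (Z : Set X) (hZ : IsMinimalComponent S Z), IsOdometer hZ.restriction := by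
  have hper' : ∀ n, ∃ q : ℕ, 0 < q ∧ ∀ d : ℤ,
      Function.Periodic (fun k : ℤ => c n ((S ^ k) x₀)) d ↔ (q : ℤ) ∣ d := fun n => by
    obtain ⟨P, hP, h⟩ := hper n
    exact exists_period hP h
  choose q hpos hq using hper'
  have hr' : ∀ n p, n ≤ p → ∀ x y, c p x = c p y → c n x = c n y := by
    intro n p h
    induction p, h using Nat.le_induction with
    | base => exact fun _ _ => id
    | succ p _ ih => exact fun x y hxy => ih x y (hr p x y hxy)
  have hdvd : ∀ n p, n ≤ p → q n ∣ q p := fun n p h => by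
    have := (hq p (q p)).2 dvd_rfl
    exact_mod_cast (hq n (q p)).1 fun k => hr' n p h _ _ (this k)
  have hmono : Monotone q := fun n p h => Nat.le_of_dvd (hpos p) (hdvd n p h)
  -- Bounded periods would all divide one `q n`; as the levels separate points, `x₀` would be a
  -- periodic point.
  have hunb : ∀ n, ∃ m, q n < q m := by
    intro n
    by_contra! h
    refine hS.not_periodic x₀ (hpos n) fun k => hsep _ _ fun m => ?_
    have h1 : q m ∣ q n := by
      rcases le_total m n with h2 | h2
      · exact hdvd m n h2
      · rw [le_antisymm (h m) (hmono h2)]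
    exact (hq m (q n)).2 (by exact_mod_cast h1) k
  have htop : Filter.Tendsto q Filter.atTop Filter.atTop := by
    refine Filter.tendsto_atTop_atTop_of_monotone hmono fun b => ?_
    induction b with
    | zero => exact ⟨0, Nat.zero_le _⟩
    | succ b ih =>
      obtain ⟨n, hn⟩ := ih
      obtain ⟨m, hm⟩ := hunb n
      exact ⟨m, by omega⟩
  -- A subsequence of levels makes the periods strictly increasing and, since `n ≤ ψ n`, still
  -- separates points.
  obtain ⟨ψ, hψ, hqψ⟩ := Filter.strictMono_subseq_of_tendsto_atTop htop
  exact exists_odometer_of_periods (c := fun n => c (ψ n)) (q := q ∘ ψ) (x₀ := x₀)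
    (fun n => hc _) (fun n => hr' _ _ (hψ.monotone (Nat.le_succ n)))
    (fun x y h => hsep x y fun n => hr' n (ψ n) hψ.le_apply _ _ (h n)) (fun n => hq _)
    (fun n => hpos _) (fun n => hdvd _ _ (hψ.monotone (Nat.le_succ n))) hqψ

end Odometer

/-- A locally constant function on a compact metric space is constant on small balls. -/
theorem _root_.IsLocallyConstant.exists_pos_forall_dist_le {X D : Type*} [PseudoMetricSpace X]
    [CompactSpace X] {f : X → D} (hf : IsLocallyConstant f) :
    ∃ δ : ℝ, 0 < δ ∧ ∀ x y, dist x y ≤ δ → f x = f y := by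
  obtain ⟨δ, hδ, h⟩ := lebesgue_number_lemma_of_metric (isCompact_univ (X := X))
    (c := fun d => f ⁻¹' {d}) (fun d => hf.isOpen_fiber d) fun x _ => mem_iUnion.2 ⟨f x, rfl⟩
  refine ⟨δ / 2, by positivity, fun x y hxy => ?_⟩
  obtain ⟨d, hd⟩ := h x (mem_univ x)
  have h1 : f x = d := hd (Metric.mem_ball_self hδ)
  have h2 : f y = d := hd (by rw [Metric.mem_ball, dist_comm]; linarith)
  rw [h1, h2]

end BratteliVershik

theorem mainTheorem4 {X : Type*} [MetricSpace X] [CompactSpace X] [TotallyDisconnectedSpace X]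
    (S : X ≃ₜ X) (hS : BratteliVershik.Aperiodic S)
    (K : ℕ) (hK : BratteliVershik.HasTopologicalRank S K)
    (hodo : ∀ (Z : Set X) (hZ : BratteliVershik.IsMinimalComponent S Z),
      ¬ BratteliVershik.IsOdometer hZ.restriction) :
    BratteliVershik.Expansive S := by
  rcases isEmpty_or_nonempty X with hX | hX
  · exact ⟨1, one_pos, fun x => hX.elim x⟩
  obtain ⟨B, φ, hφ, hcard, h, hconj⟩ := hK.1
  let T := hφ.towers h hconj
  have hsep : ∀ x y, (∀ n, T.κ n x = T.κ n y) → x = y := fun x y => hφ.eq_of_κ_eq h hconj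
  have hloc : ∀ n, IsLocallyConstant (T.κ n) := hφ.isLocallyConstant_κ h hconj
  obtain ⟨N, hN⟩ := T.exists_level fun n => (hφ.card_towers_le h hconj n).trans (hcard n)
  -- Points whose orbits stay within `δ` have the same itinerary at level `N`.
  obtain ⟨δ, hδ, hball⟩ := (hloc N).exists_pos_forall_dist_le
  refine ⟨δ, hδ, fun x y hxy => ?_⟩
  by_contra! hdist
  rcases hN x y fun k => hball _ _ (hdist k) with h1 | h1
  · exact hxy (hsep x y h1)
  · obtain ⟨Z, hZ, hZ'⟩ := BratteliVershik.exists_odometer hS hloc T.refines hsep h1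
    exact hodo Z hZ hZ'
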